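/- Let $k$ be a subfield of $\mathbb{R}$ and let $k_0\subseteq k$ be a computable subfield, i.e. fix a surjective numbering $\nu:\mathbb{N}\to k_0$ for which equality is decidable and addition and multiplication are given by computable functions on numbers. For $M\in\{\mathbb{N},\mathbb{Z}\}$ let $k^M$ be the ring of sequences $(x_i)_{i\in M}$ in $k$ with componentwise operations and with the shift $\sigma\big((x_i)_{i\in M}\big)=(x_{i+1})_{i\in M}$. A finite system of difference equations over $k_0$ consists of $n\in\mathbb{N}$ and finitely many equations $f_1=\dots=f_\ell=0$ with $f_1,\dots,f_\ell\in k_0[\sigma^j(X_i)\mid 1\le i\le n,\ j\in\mathbb{N}]$; a solution in $k^M$ is a tuple $(x_1,\dots,x_n)\in (k^M)^n$ such that every $f_r$ becomes the zero sequence when each $\sigma^j(X_i)$ is replaced by $\sigma^j(x_i)$ and constants are read as constant sequences. Systems are given to an algorithm as finite data: $n$, together with the list of terms of each $f_r$, with coefficients represented by their $\nu$-numbers. Then there is no algorithm that, given a finite system of difference equations over $k_0$, decides whether it has a solution in $k^{\mathbb{N}}$; and there is no algorithm that, given a finite system of difference equations over $k_0$, decides whether it has a solution in $k^{\mathbb{Z}}$.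 -/

import Mathlib

namespace DiffEq

/-- A computable presentation of a field `K`: a surjective numbering `ν : ℕ → K` of the elements
such that equality of numbered elements is decidable and addition and multiplication are
performed on numbers by computable functions.  (Negation, and inversion of nonzero elements, are
then computable too, by search.)  A presentation by an injective coding of `K` onto a decidable
set of natural numbers is a special case: let numbers outside of that set denote `0`. -/
structure IsComputablePresentation {K : Type*} [Field K] (ν : ℕ → K) : Prop where
  surjective : Function.Surjective ν
  decidable_eq : ComputablePred fun p : ℕ × ℕ => ν p.1 = ν p.2
  computable_add : ∃ f : ℕ → ℕ → ℕ, Computable₂ f ∧ ∀ a b, ν (f a b) = ν a + ν b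
  computable_mul : ∃ f : ℕ → ℕ → ℕ, Computable₂ f ∧ ∀ a b, ν (f a b) = ν a * ν b

/-- The endomorphism `σ ((x_i)_{i ∈ M}) = (x_{i+1})_{i ∈ M}` of the ring of sequences `R^M`
(used for `M = ℕ` and `M = ℤ`). -/
def shift (M R : Type*) [AddMonoidWithOne M] [CommRing R] : (M → R) →+* (M → R) where
  toFun x := fun i => x (i + 1)
  map_one' := rfl
  map_mul' _ _ := rfl
  map_zero' := rfl
  map_add' _ _ := rfl

/-- Difference polynomials in `X_0, …, X_{n-1}` over a ring `A` of constants: the polynomial ring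
in the indeterminates `σ^j(X_i)`; the pair `(i, j)` stands for `σ^j(X_i)`. -/
abbrev DiffPoly (A : Type*) [CommRing A] (n : ℕ) : Type _ :=
  MvPolynomial (Fin n × ℕ) A

/-- The value of difference polynomials at an `n`-tuple `x` of sequences: the `A`-algebra map to
`R^M` (constants go to constant sequences) that sends `σ^j(X_i)` to `σ^j(x_i)`. -/
noncomputable def evalSeq {A M R : Type*} [CommRing A] [AddMonoidWithOne M] [CommRing R]
    [Algebra A R] {n : ℕ} (x : Fin n → M → R) : DiffPoly A n →ₐ[A] (M → R) :=
  MvPolynomial.aeval fun v : Fin n × ℕ => (shift M R)^[v.2] (x v.1)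

/-- A finite system `f_1 = ⋯ = f_ℓ = 0` of difference equations over `A` in finitely many
unknowns. -/
structure DiffSystem (A : Type*) [CommRing A] where
  /-- The number of unknowns. -/
  numVars : ℕ
  /-- The left-hand sides of the equations. -/
  eqs : List (DiffPoly A numVars)

/-- The system has a solution in the ring of sequences `R^M`. -/
def DiffSystem.HasSolution {A : Type*} [CommRing A] (F : DiffSystem A)
    (M R : Type*) [AddMonoidWithOne M] [CommRing R] [Algebra A R] : Prop :=
  ∃ x : Fin F.numVars → M → R, ∀ f ∈ F.eqs, evalSeq x f = 0

/-- Code of a term: the number of its coefficient and the list of its factors `σ^j(X_i)`, each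
given as `(i, j)` and repeated according to its multiplicity. -/
abbrev TermCode : Type := ℕ × List (ℕ × ℕ)

/-- Code of a difference polynomial: the list of the codes of its terms. -/
abbrev PolyCode : Type := List TermCode

/-- Code of a finite system: the number of unknowns and the list of codes of the left-hand
sides. -/
abbrev SystemCode : Type := ℕ × List PolyCode

/-- The polynomial written down by a code, in the indeterminates `σ^j(X_i)` with `i ∈ ℕ`, where
coefficients are read through the numbering `ν`. -/
noncomputable def PolyCode.toPoly {A : Type*} [CommRing A] (ν : ℕ → A) (p : PolyCode) :
    MvPolynomial (ℕ × ℕ) A :=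
  (p.map fun t => MvPolynomial.C (ν t.1) * (t.2.map MvPolynomial.X).prod).sum

/-- The code `w` describes the system `F`, where coefficients are numbered by `ν`. -/
def Codes {A : Type*} [CommRing A] (ν : ℕ → A) (w : SystemCode) (F : DiffSystem A) : Prop :=
  w.1 = F.numVars ∧
    w.2.map (PolyCode.toPoly ν) =
      F.eqs.map (MvPolynomial.rename fun v : Fin F.numVars × ℕ => ((v.1 : ℕ), v.2))

/-- The property `P` of finite systems of difference equations over `A` is decidable, with respect
to the numbering `ν` of the coefficients: there is an algorithm (a partial recursive function `D`)
which, given any code of any system `F`, halts and answers whether `P F` holds. -/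
def IsDecidableProblem {A : Type*} [CommRing A] (ν : ℕ → A) (P : DiffSystem A → Prop) : Prop :=
  ∃ D : SystemCode →. Bool, Partrec D ∧
    ∀ (w : SystemCode) (F : DiffSystem A), Codes ν w F → ∃ b ∈ D w, (b = true ↔ P F)

end DiffEq

/-! The halting problem reduces to solvability. Some Turing machine with finitely many states and
symbols halts on `a₀ a₁ a₂ ⋯ a₂` (`m` copies of `a₂`) exactly when the `m`-th program halts on 0
(`exists_machine_of_partrec`). One step of the index simulates one step of the machine: idempotents
with sum 1 mark the state and the scanned symbol, and each half of the tape is a number in a fixed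
radix. Multiplication by the idempotents turns case distinctions into equations. The digits are less
than half the radix, so these numbers lie in [0, 1/2]; imposing this range through sums of four
squares makes the leading digit unique (`digit_unique`).

Shift-invariant equations cannot prescribe an initial value. Instead, the machine is restarted on
its input after every halt, and a clock, reset at each restart, may not exceed a constant. As the
field is Archimedean, every solution has halts at arbitrarily late indices; from a restart on it
follows the genuine run, which therefore halts (`halts_of_simulates`). Conversely, a halting run
repeated forever is a periodic rational solution, over ℕ and over ℤ (`exists_simulates_of_halts`).
Only the equation `pow = base ^ m` depends on `m`, so the system is computable from `m`
(`computablePred_of_isDecidableProblem`). -/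

namespace DiffEq

/-! ### Finite Turing machines with inputs of a simple shape -/

open Turing

/-- Powers of two serve as inputs because their binary expansion repeats a single symbol, which
makes the number coding the tape a geometric sum. -/
theorem trNat_two_pow (m : ℕ) :
    PartrecToTM2.trNat (2 ^ m) =
      List.replicate m PartrecToTM2.Γ'.bit0 ++ [PartrecToTM2.Γ'.bit1] := by
  have key : ∀ m : ℕ, ∃ p : PosNum, ((2 ^ m : ℕ) : Num) = Num.pos p ∧
      PartrecToTM2.trPosNum p =
        List.replicate m PartrecToTM2.Γ'.bit0 ++ [PartrecToTM2.Γ'.bit1] := by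
    intro m
    induction m with
    | zero => exact ⟨PosNum.one, rfl, rfl⟩
    | succ m ih =>
      obtain ⟨p, hp, hq⟩ := ih
      refine ⟨p.bit0, ?_, ?_⟩
      · rw [pow_succ, mul_two, Nat.cast_add, hp]
        exact Num.bit0_of_bit0 (Num.pos p)
      · simp [PartrecToTM2.trPosNum, hq, List.replicate_succ]
  obtain ⟨p, hp, hq⟩ := key m
  rw [PartrecToTM2.trNat, hp, ← hq]
  rfl

/-- The machine `M` halts on the input `l`. -/
def Halts {Γ Λ : Type} [Inhabited Γ] [Inhabited Λ] (M : TM0.Machine Γ Λ) (l : List Γ) : Prop :=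
  (StateTransition.eval (TM0.step M) (TM0.init l)).Dom

/-- The system has one unknown per pair of state and symbol, so the states must form a finite type;
a finite supporting set is never left and can replace `Λ`. -/
theorem exists_finite_machine {Γ Λ : Type} [Inhabited Γ] [Inhabited Λ] (M : TM0.Machine Γ Λ)
    (S : Set Λ) (hS : S.Finite) (ss : TM0.Supports M S) :
    ∃ (Λ' : Type) (_ : Inhabited Λ') (_ : Fintype Λ') (M' : TM0.Machine Γ Λ'),
      ∀ l, Halts M' l ↔ Halts M l := by
  classical
  have : Fintype S := hS.fintype
  let _ : Inhabited S := ⟨⟨default, ss.1⟩⟩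
  let g : PointedMap Λ S := ⟨fun q => if h : q ∈ S then ⟨q, h⟩ else default, by
    rw [dif_pos ss.1]; rfl⟩
  let i : PointedMap Γ Γ := ⟨id, rfl⟩
  have hg : ∀ q ∈ S, ((g q : S) : Λ) = q := fun q hq => by
    change ((if h : q ∈ S then (⟨q, h⟩ : S) else default : S) : Λ) = q
    rw [dif_pos hq]
  refine ⟨S, inferInstance, inferInstance, M.map i i g Subtype.val, fun l => ?_⟩
  have h := TM0.Machine.map_respects M i i g Subtype.val ss (fun _ => rfl) hg
  have := StateTransition.tr_eval_dom h (a₁ := TM0.init l) (a₂ := TM0.init l) ⟨ss.1, ?_⟩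
  · exact this
  · rw [TM0.map_init]
    congr 1
    exact List.map_id l

theorem exists_machine_of_partrec {f : ℕ →. ℕ} (hf : Partrec f) :
    ∃ (Γ Λ : Type) (_ : Inhabited Γ) (_ : Fintype Γ) (_ : Inhabited Λ) (_ : Fintype Λ)
      (M : TM0.Machine Γ Λ) (a₀ a₁ a₂ : Γ),
      ∀ m, Halts M (a₀ :: a₁ :: List.replicate m a₂) ↔ (f m).Dom := by
  -- The machine is built for the function that recovers `m` from `2 ^ m` by search and then applies
  -- `f`.
  have hg : Partrec fun x : ℕ => (Nat.rfind fun m => Part.some (decide (2 ^ m = x))).bind f := by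
    refine Partrec.bind (Partrec.rfind ?_) (hf.comp Computable.snd).to₂
    have hpow : Primrec fun m : ℕ => 2 ^ m :=
      (Primrec.nat_rec₁ 1 ((Primrec.nat_mul.comp Primrec.snd (Primrec.const 2)).to₂)).of_eq
        fun m => by induction m with
          | zero => rfl
          | succ m ih => rw [pow_succ, ← ih]
    have := (Primrec.eq (α := ℕ)).comp (hpow.comp Primrec.snd) (Primrec.fst (α := ℕ) (β := ℕ))
    obtain ⟨_, h⟩ := this
    refine Computable.partrec (Computable.of_eq h.to_comp ?_)
    rintro ⟨a, b⟩
    simp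
  have hgdom : ∀ m, ((Nat.rfind fun j => Part.some (decide (2 ^ j = 2 ^ m))).bind f).Dom ↔
      (f m).Dom := by
    intro m
    have : (Nat.rfind fun j => Part.some (decide (2 ^ j = 2 ^ m))) = Part.some m := by
      refine Part.eq_some_iff.2 (Nat.mem_rfind.2 ⟨by simp, fun {j} hj => ?_⟩)
      simp [hj.ne]
    rw [this]
    exact iff_of_eq (congrArg Part.Dom (Part.bind_some m f))
  obtain ⟨c, hc⟩ := ToPartrec.Code.exists_code (Nat.Partrec'.part_iff₁.2 hg)
  let _ : Inhabited PartrecToTM2.Λ' := ⟨PartrecToTM2.trNormal c PartrecToTM2.Cont'.halt⟩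
  have : Fintype PartrecToTM2.K' :=
    ⟨{.main, .rev, .aux, .stack}, fun x => by cases x <;> simp⟩
  have s2 := TM2to1.tr_supports PartrecToTM2.tr
    (PartrecToTM2.tr_supports c PartrecToTM2.Cont'.halt)
  have s1 := TM1to0.tr_supports (TM2to1.tr PartrecToTM2.tr) s2
  obtain ⟨Λ', i1, i2, M', hM'⟩ := exists_finite_machine _ _ (Finset.finite_toSet _) s1
  let sym (o : Option PartrecToTM2.Γ') : PartrecToTM2.K' → Option PartrecToTM2.Γ' :=
    Function.update (fun _ => none) PartrecToTM2.K'.main o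
  refine ⟨TM2to1.Γ' PartrecToTM2.K' fun _ => PartrecToTM2.Γ', Λ', inferInstance, inferInstance,
    i1, i2, M', (true, sym (some .cons)), (false, sym (some .bit1)), (false, sym (some .bit0)),
    fun m => ?_⟩
  rw [hM', ← hgdom]
  -- The tape stores the stack from the bottom up: the separator `cons` (with the bottom mark
  -- `true`), the leading bit, then the zeros.
  have e0 : ((true, sym (some .cons)) :: (false, sym (some .bit1)) ::
      List.replicate m (false, sym (some .bit0)) : List (TM2to1.Γ' _ fun _ => PartrecToTM2.Γ')) =
      TM2to1.trInit PartrecToTM2.K'.main (PartrecToTM2.trList [2 ^ m]) := by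
    simp only [TM2to1.trInit, PartrecToTM2.trList, trNat_two_pow, sym, List.append_assoc,
      List.reverse_append, List.reverse_cons, List.reverse_nil, List.nil_append,
      List.cons_append, List.reverse_replicate]
    exact congrArg (fun l => (true, sym (some .cons)) :: (false, sym (some .bit1)) :: l)
      (List.map_replicate (f := fun a => (false, sym (some a)))).symm
  have e1 : Halts (TM1to0.tr (TM2to1.tr PartrecToTM2.tr))
      (TM2to1.trInit PartrecToTM2.K'.main (PartrecToTM2.trList [2 ^ m])) ↔
      (TM0.eval (TM1to0.tr (TM2to1.tr PartrecToTM2.tr))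
      (TM2to1.trInit PartrecToTM2.K'.main (PartrecToTM2.trList [2 ^ m]))).Dom := Iff.rfl
  have e2 : (TM2.init PartrecToTM2.K'.main (PartrecToTM2.trList [2 ^ m]) : PartrecToTM2.Cfg') =
      PartrecToTM2.init c [2 ^ m] := by
    unfold TM2.init PartrecToTM2.init
    congr 1
    funext k
    cases k <;> rfl
  have e3 : (TM2.eval PartrecToTM2.tr PartrecToTM2.K'.main (PartrecToTM2.trList [2 ^ m])).Dom ↔
      (StateTransition.eval (TM2.step PartrecToTM2.tr) (PartrecToTM2.init c [2 ^ m])).Dom := by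
    rw [← e2]; rfl
  rw [e0, e1, TM1to0.tr_eval]
  refine (TM2to1.tr_eval_dom _ _ _).trans (e3.trans ?_)
  rw [PartrecToTM2.tr_eval]
  have e4 := hc ⟨[2 ^ m], rfl⟩
  change c.eval [2 ^ m] = _ at e4
  rw [e4]
  rfl

open MvPolynomial

/-! ### Relations definable by difference polynomials -/

section PolyRel

variable {A K V : Type*} [CommRing A] [CommRing K] [Algebra A K]

variable (A) in
/-- `g` is given by a difference polynomial, evaluated at `w j v`, the value of `σ^j(X_v)`. -/
def IsPolyFun (g : (ℕ → V → K) → K) : Prop :=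
  ∃ f : MvPolynomial (V × ℕ) A, ∀ w : ℕ → V → K, aeval (fun p : V × ℕ => w p.2 p.1) f = g w

variable (A) in
/-- `P` is given by the vanishing of finitely many difference polynomials. -/
def IsPolyRel (P : (ℕ → V → K) → Prop) : Prop :=
  ∃ E : List (MvPolynomial (V × ℕ) A), ∀ w : ℕ → V → K,
    P w ↔ ∀ f ∈ E, aeval (fun p : V × ℕ => w p.2 p.1) f = 0

namespace IsPolyFun

theorem var (j : ℕ) (v : V) : IsPolyFun A fun w : ℕ → V → K => w j v :=
  ⟨X (v, j), fun w => by simp⟩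

theorem natCast (n : ℕ) : IsPolyFun A fun _ : ℕ → V → K => (n : K) :=
  ⟨(n : MvPolynomial (V × ℕ) A), fun w => by simp⟩

theorem zero : IsPolyFun A fun _ : ℕ → V → K => (0 : K) := ⟨0, fun w => by simp⟩

theorem one : IsPolyFun A fun _ : ℕ → V → K => (1 : K) := ⟨1, fun w => by simp⟩

variable {g h : (ℕ → V → K) → K}

theorem add (hg : IsPolyFun A g) (hh : IsPolyFun A h) : IsPolyFun A fun w => g w + h w := by
  obtain ⟨p, hp⟩ := hg
  obtain ⟨q, hq⟩ := hh
  exact ⟨p + q, fun w => by rw [map_add, hp, hq]⟩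

theorem sub (hg : IsPolyFun A g) (hh : IsPolyFun A h) : IsPolyFun A fun w => g w - h w := by
  obtain ⟨p, hp⟩ := hg
  obtain ⟨q, hq⟩ := hh
  exact ⟨p - q, fun w => by rw [map_sub, hp, hq]⟩

theorem mul (hg : IsPolyFun A g) (hh : IsPolyFun A h) : IsPolyFun A fun w => g w * h w := by
  obtain ⟨p, hp⟩ := hg
  obtain ⟨q, hq⟩ := hh
  exact ⟨p * q, fun w => by rw [map_mul, hp, hq]⟩

theorem pow (hg : IsPolyFun A g) (n : ℕ) : IsPolyFun A fun w => g w ^ n := by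
  obtain ⟨p, hp⟩ := hg
  exact ⟨p ^ n, fun w => by rw [map_pow, hp]⟩

theorem sum {ι : Type*} (s : Finset ι) {g : ι → (ℕ → V → K) → K}
    (hg : ∀ i, IsPolyFun A (g i)) : IsPolyFun A fun w => ∑ i ∈ s, g i w := by
  choose p hp using hg
  exact ⟨∑ i ∈ s, p i, fun w => by simp only [map_sum, hp]⟩

end IsPolyFun

namespace IsPolyRel

theorem eq {g h : (ℕ → V → K) → K} (hg : IsPolyFun A g) (hh : IsPolyFun A h) :
    IsPolyRel A fun w => g w = h w := by
  obtain ⟨p, hp⟩ := hg.sub hh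
  exact ⟨[p], fun w => by simp [hp, sub_eq_zero]⟩

theorem and {P Q : (ℕ → V → K) → Prop} (hP : IsPolyRel A P) (hQ : IsPolyRel A Q) :
    IsPolyRel A fun w => P w ∧ Q w := by
  obtain ⟨E, hE⟩ := hP
  obtain ⟨E', hE'⟩ := hQ
  exact ⟨E ++ E', fun w => by simp [hE, hE', or_imp, forall_and]⟩

theorem all {ι : Type*} [Finite ι] {P : ι → (ℕ → V → K) → Prop} (hP : ∀ i, IsPolyRel A (P i)) :
    IsPolyRel A fun w => ∀ i, P i w := by
  have := Fintype.ofFinite ι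
  choose E hE using hP
  refine ⟨Finset.univ.toList.flatMap E, fun w => ?_⟩
  simp only [hE, List.mem_flatMap, Finset.mem_toList, Finset.mem_univ, true_and]
  exact ⟨fun h f ⟨i, hi⟩ => h i f hi, fun h i f hi => h f ⟨i, hi⟩⟩

end IsPolyRel

end PolyRel

/-! ### Pointwise evaluation and computable coding of systems -/

section Eval

variable {A M K : Type*} [CommRing A] [AddMonoidWithOne M] [CommRing K] [Algebra A K]

theorem shift_iterate_apply (j : ℕ) (x : M → K) (i : M) : (shift M K)^[j] x i = x (i + j) := by
  induction j generalizing i with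
  | zero => simp
  | succ j ih =>
    rw [Function.iterate_succ_apply']
    change (shift M K)^[j] x (i + 1) = _
    rw [ih, add_assoc, Nat.cast_succ, ← Nat.cast_one, ← Nat.cast_add, ← Nat.cast_add, add_comm 1 j]

theorem evalSeq_apply {n : ℕ} (x : Fin n → M → K) (f : DiffPoly A n) (i : M) :
    evalSeq x f i = aeval (fun p : Fin n × ℕ => x p.1 (i + p.2)) f := by
  have : (Pi.evalAlgHom A (fun _ : M => K) i).comp (evalSeq x) =
      aeval (fun p : Fin n × ℕ => x p.1 (i + p.2)) := by
    refine MvPolynomial.algHom_ext fun p => ?_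
    simp [evalSeq, shift_iterate_apply]
  exact DFunLike.congr_fun this f

end Eval

section Coding

variable {A : Type*} [CommRing A] {ν : ℕ → A}

theorem exists_polyCode (hν : Function.Surjective ν) (q : MvPolynomial (ℕ × ℕ) A) :
    ∃ c : PolyCode, c.toPoly ν = q := by
  induction q using MvPolynomial.induction_on with
  | C a =>
    obtain ⟨n, rfl⟩ := hν a
    exact ⟨[(n, [])], by simp [PolyCode.toPoly]⟩
  | add p q hp hq =>
    obtain ⟨c, rfl⟩ := hp
    obtain ⟨d, rfl⟩ := hq
    exact ⟨c ++ d, by simp [PolyCode.toPoly]⟩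
  | mul_X p v hp =>
    obtain ⟨c, rfl⟩ := hp
    refine ⟨c.map fun t => (t.1, v :: t.2), ?_⟩
    simp only [PolyCode.toPoly, List.map_map, ← List.sum_map_mul_right]
    congr 1
    refine List.map_congr_left fun t _ => ?_
    simp only [Function.comp_apply, List.map_cons, List.prod_cons]
    ring

theorem primrec_replicate {α : Type*} [Primcodable α] (a : α) :
    Primrec fun m : ℕ => List.replicate m a :=
  (Primrec.list_map Primrec.list_range (Primrec.const a).to₂).of_eq fun m => by
    simp [List.map_const']

/-- If solvability of systems with coefficients in `A` is decidable, then so is solvability of the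
members of the family of systems that is obtained by adding the equation `z = y ^ m` to a fixed
system. -/
theorem computablePred_of_isDecidableProblem {M K V : Type*} [AddMonoidWithOne M] [CommRing K]
    [Algebra A K] [Finite V] (hν : Function.Surjective ν)
    (hdec : IsDecidableProblem ν fun F : DiffSystem A => F.HasSolution M K)
    {P : (ℕ → V → K) → Prop} (hP : IsPolyRel A P) (y z : V) :
    ComputablePred fun m : ℕ => ∃ x : M → V → K, ∀ i,
      P (fun j => x (i + j)) ∧ x i z = x i y ^ m := by
  obtain ⟨n, ⟨e⟩⟩ := Finite.exists_equiv_fin V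
  obtain ⟨E, hE⟩ := hP
  obtain ⟨D, hD, hD'⟩ := hdec
  -- This choice need not be computable: it is applied only to the fixed list `E'`, so it
  -- contributes a constant to `W`.
  choose code hcode using exists_polyCode hν
  obtain ⟨c₁, hc₁⟩ := hν 1
  obtain ⟨c₂, hc₂⟩ := hν (-1)
  let E' : List (DiffPoly A n) := E.map (rename (Prod.map e id))
  let r : DiffPoly A n → MvPolynomial (ℕ × ℕ) A := rename fun v : Fin n × ℕ => ((v.1 : ℕ), v.2)
  let F (m : ℕ) : DiffSystem A := ⟨n, E' ++ [X (e z, 0) - X (e y, 0) ^ m]⟩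
  let W (m : ℕ) : SystemCode := (n, (E'.map fun f => code (r f)) ++
    [[(c₁, [((e z : ℕ), 0)]), (c₂, List.replicate m ((e y : ℕ), 0))]])
  have hW : Primrec W := by
    refine Primrec.pair (Primrec.const n)
      ((Primrec.list_append (α := PolyCode)).comp (Primrec.const _) ?_)
    refine (Primrec.list_cons (α := PolyCode)).comp ?_ (Primrec.const [])
    refine (Primrec.list_cons (α := TermCode)).comp (Primrec.const _) ?_
    refine (Primrec.list_cons (α := TermCode)).comp ?_ (Primrec.const [])
    exact Primrec.pair (Primrec.const c₂) (primrec_replicate _)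
  have hcodes (m : ℕ) : Codes ν (W m) (F m) := by
    refine ⟨rfl, ?_⟩
    simp only [W, F, List.map_append, List.map_map, List.map_cons, List.map_nil]
    congr 1
    · exact List.map_congr_left fun f _ => hcode _
    · simp [PolyCode.toPoly, hc₁, hc₂, sub_eq_add_neg]
  have hsol (m : ℕ) : (F m).HasSolution M K ↔ ∃ x : M → V → K, ∀ i,
      P (fun j => x (i + j)) ∧ x i z = x i y ^ m := by
    have key (x : M → V → K) : (∀ f ∈ (F m).eqs, evalSeq (fun v i => x i (e.symm v)) f = 0) ↔
        ∀ i, P (fun j => x (i + j)) ∧ x i z = x i y ^ m := by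
      simp only [funext_iff, evalSeq_apply, F, E', List.mem_append, List.mem_map,
        List.mem_singleton, or_imp, forall_and, hE, Pi.zero_apply]
      refine and_congr ⟨fun h i f hf => ?_, ?_⟩ ?_
      · simpa [aeval_rename, Function.comp_def] using h _ ⟨f, hf, rfl⟩ i
      · rintro h _ ⟨f, hf, rfl⟩ i
        simpa [aeval_rename, Function.comp_def] using h i f hf
      · simp [sub_eq_zero]
    constructor
    · rintro ⟨x, hx⟩
      refine ⟨fun i v => x (e v) i, (key fun i v => x (e v) i).1 ?_⟩
      simpa using hx
    · rintro ⟨x, hx⟩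
      exact ⟨_, (key x).2 hx⟩
  refine ComputablePred.computable_iff.2 ?_
  choose b hb hb' using fun m => hD' (W m) (F m) (hcodes m)
  refine ⟨b, ?_, ?_⟩
  · have : Partrec fun m => D (W m) := hD.comp hW.to_comp
    exact this.of_eq fun m => Part.eq_some_iff.2 (hb m)
  · funext m
    exact propext ((hsol m).symm.trans (hb' m).symm)

end Coding

/-! ### Half-tapes as numbers in a fixed radix -/

section Radix

variable {Γ : Type} [Fintype Γ]

variable (Γ) in
/-- The radix in which tapes are written down. -/
def radix : ℕ := 2 * Fintype.card Γ + 3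

theorem one_lt_radix : 1 < radix Γ := by unfold radix; omega

theorem radix_pos : (0 : ℚ) < radix Γ := by exact_mod_cast one_lt_radix.le

variable [Inhabited Γ]

open scoped Classical in
/-- An injective numbering of the symbols by digits; the blank has the digit `0`. -/
noncomputable def digit (a : Γ) : ℕ := if a = default then 0 else Fintype.equivFin Γ a + 1

theorem digit_default : digit (default : Γ) = 0 := if_pos rfl

theorem digit_injective : Function.Injective (digit : Γ → ℕ) := by
  intro a b h
  by_cases ha : a = default <;> by_cases hb : b = default <;>
    simp_all [digit, Fin.val_inj]

theorem digit_le (a : Γ) : 2 * digit a + 1 ≤ radix Γ := by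
  unfold digit radix
  split_ifs
  · omega
  · have := (Fintype.equivFin Γ a).isLt
    omega

/-- The number `0.d₀d₁d₂…` in base `radix Γ`, where the `dᵢ` are the digits of the list. -/
noncomputable def listVal (l : List Γ) : ℚ := l.foldr (fun a r => (digit a + r) / radix Γ) 0

theorem listVal_cons (a : Γ) (l : List Γ) :
    listVal (a :: l) = (digit a + listVal l) / radix Γ := rfl

theorem listVal_append_blanks (l : List Γ) (n : ℕ) :
    listVal (l ++ List.replicate n default) = listVal l := by
  induction l with
  | nil =>
    induction n with
    | zero => rfl
    | succ n ih =>
      rw [List.nil_append] at ih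
      rw [List.nil_append, List.replicate_succ, listVal_cons, ih]
      simp [listVal, digit_default]
  | cons a l ih => rw [List.cons_append, listVal_cons, ih, listVal_cons]

theorem listVal_nonneg (l : List Γ) : 0 ≤ listVal l := by
  induction l with
  | nil => exact le_rfl
  | cons a l ih => rw [listVal_cons]; positivity

theorem two_mul_listVal_le (l : List Γ) : 2 * listVal l ≤ 1 := by
  induction l with
  | nil => simp [listVal]
  | cons a l ih =>
    have h := digit_le a
    have h' : (2 * digit a + 1 : ℚ) ≤ radix Γ := by exact_mod_cast h
    rw [listVal_cons, ← mul_div_assoc, div_le_one radix_pos]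
    linarith

/-- A geometric sum. The input length enters only through the `m`-th power of the reciprocal radix,
which a single unknown can hold. -/
theorem listVal_replicate (a : Γ) (m : ℕ) :
    (radix Γ - 1 : ℚ) * listVal (List.replicate m a) = digit a * (1 - (radix Γ : ℚ)⁻¹ ^ m) := by
  have h := (radix_pos (Γ := Γ)).ne'
  induction m with
  | zero => simp [listVal]
  | succ m ih =>
    rw [List.replicate_succ, listVal_cons, ← mul_div_assoc, mul_add, ih, pow_succ]
    field_simp
    ring

/-- The number `0.d₀d₁d₂…` for a half of a tape. -/
noncomputable def tapeVal (L : ListBlank Γ) : ℚ :=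
  ListBlank.liftOn L listVal fun l l' h => by
    obtain ⟨n, rfl⟩ := h
    exact (listVal_append_blanks l n).symm

theorem tapeVal_mk (l : List Γ) : tapeVal (ListBlank.mk l) = listVal l := rfl

theorem tapeVal_nonneg (L : ListBlank Γ) : 0 ≤ tapeVal L := by
  induction L using ListBlank.induction_on with
  | h l => exact listVal_nonneg l

theorem two_mul_tapeVal_le (L : ListBlank Γ) : 2 * tapeVal L ≤ 1 := by
  induction L using ListBlank.induction_on with
  | h l => exact two_mul_listVal_le l

theorem radix_mul_tapeVal_cons (a : Γ) (L : ListBlank Γ) :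
    radix Γ * tapeVal (L.cons a) = digit a + tapeVal L := by
  induction L using ListBlank.induction_on with
  | h l =>
    rw [ListBlank.cons_mk, tapeVal_mk, tapeVal_mk, listVal_cons]
    exact mul_div_cancel₀ _ radix_pos.ne'

theorem radix_mul_tapeVal (L : ListBlank Γ) :
    radix Γ * tapeVal L = digit L.head + tapeVal L.tail := by
  rw [← radix_mul_tapeVal_cons, ListBlank.cons_head_tail]

/-- Both remainders lie in [0, 1/2], so the two digits differ by less than 1. The bound 1/2 replaces
a strict bound by 1, because sums of squares express only weak inequalities. -/
theorem digit_unique {K : Type*} [Field K] [LinearOrder K] [IsStrictOrderedRing K] {a : Γ}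
    {L : ListBlank Γ} {x y : K} (hx : x = (tapeVal L : ℚ)) (hy : 0 ≤ y) (hy' : 2 * y ≤ 1)
    (h : y + digit a = radix Γ * x) : a = L.head ∧ y = (tapeVal L.tail : ℚ) := by
  have h1 : (radix Γ : K) * (tapeVal L : ℚ) = digit L.head + (tapeVal L.tail : ℚ) := by
    exact_mod_cast radix_mul_tapeVal L
  have h2 : (0 : K) ≤ (tapeVal L.tail : ℚ) := by exact_mod_cast tapeVal_nonneg L.tail
  have h3 : 2 * ((tapeVal L.tail : ℚ) : K) ≤ 1 := by exact_mod_cast two_mul_tapeVal_le L.tail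
  rw [hx, h1] at h
  have h4 : digit a = digit L.head := by
    have l1 : (digit a : K) < digit L.head + 1 := by linarith
    have l2 : (digit L.head : K) < digit a + 1 := by linarith
    norm_cast at l1 l2
    omega
  refine ⟨digit_injective h4, ?_⟩
  rw [h4] at h
  linarith

end Radix

/-! ### The simulating system -/

/-- The unknowns of the system that simulates a Turing machine: indicators of the pairs of a state
and a scanned symbol, the two halves of the tape, a clock and its bound, the reciprocal of the radix
and a power of it, and roots for sums of four squares. -/
inductive Var (P : Type) : Type
  | mode (p : P)
  | left
  | right
  | time
  | bound
  | base
  | pow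
  | aux (s : Fin 5) (j : Fin 4)

instance {P : Type} [Finite P] : Finite (Var P) := by
  let f : Var P → P ⊕ (Fin 6 ⊕ Fin 5 × Fin 4) := fun v => match v with
    | .mode p => .inl p
    | .left => .inr (.inl 0)
    | .right => .inr (.inl 1)
    | .time => .inr (.inl 2)
    | .bound => .inr (.inl 3)
    | .base => .inr (.inl 4)
    | .pow => .inr (.inl 5)
    | .aux s j => .inr (.inr (s, j))
  refine Finite.of_injective f fun v v' h => ?_
  cases v <;> cases v' <;> simp_all [f]

section Relation

variable {Γ Λ : Type} [Inhabited Γ] [Fintype Γ] [Inhabited Λ] [Fintype Λ]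
variable {K : Type*} [Field K]

/-- What a transition (or a halt, if there is none) from the mode `p` demands of the current
values `u` and the next values `v`.  After a halt the machine is started again on
`a₀ a₁ a₂ … a₂`. -/
def Transition (a₀ a₁ a₂ : Γ) (p : Λ × Γ) (u v : Var (Λ × Γ) → K) :
    Option (Λ × TM0.Stmt Γ) → Prop
  | none =>
    u (.mode p) * v (.mode (default, a₀)) = u (.mode p) ∧
    u (.mode p) * v .left = 0 ∧
    u (.mode p) * ((radix Γ - 1) * (radix Γ * v .right)) =
      u (.mode p) * ((radix Γ - 1) * digit a₁ + digit a₂ * (1 - u .pow)) ∧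
    u (.mode p) * v .time = 0
  | some (q, .write b) =>
    u (.mode p) * v (.mode (q, b)) = u (.mode p) ∧
    u (.mode p) * v .left = u (.mode p) * u .left ∧
    u (.mode p) * v .right = u (.mode p) * u .right ∧
    u (.mode p) * v .time = u (.mode p) * (u .time + 1)
  | some (q, .move .left) =>
    u (.mode p) * ∑ b, v (.mode (q, b)) = u (.mode p) ∧
    u (.mode p) * (radix Γ * v .right) = u (.mode p) * (digit p.2 + u .right) ∧
    u (.mode p) * (v .left + ∑ b, v (.mode (q, b)) * digit b) =
      u (.mode p) * (radix Γ * u .left) ∧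
    u (.mode p) * v .time = u (.mode p) * (u .time + 1)
  | some (q, .move .right) =>
    u (.mode p) * ∑ b, v (.mode (q, b)) = u (.mode p) ∧
    u (.mode p) * (radix Γ * v .left) = u (.mode p) * (digit p.2 + u .left) ∧
    u (.mode p) * (v .right + ∑ b, v (.mode (q, b)) * digit b) =
      u (.mode p) * (radix Γ * u .right) ∧
    u (.mode p) * v .time = u (.mode p) * (u .time + 1)

/-- The quantities that have to be nonnegative. -/
def slack (u : Var (Λ × Γ) → K) : Fin 5 → K :=
  ![u .left, 1 - 2 * u .left, u .right, 1 - 2 * u .right, u .bound - u .time]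

/-- The relation between consecutive values that simulates the machine `M`, restarted on
`a₀ a₁ a₂ … a₂` after each halt, with a bound for the running time. -/
structure Simulates (M : TM0.Machine Γ Λ) (a₀ a₁ a₂ : Γ) (u v : Var (Λ × Γ) → K) : Prop where
  idem : ∀ p, u (.mode p) * u (.mode p) = u (.mode p)
  sum_eq : ∑ p, u (.mode p) = 1
  slack_eq : ∀ s, slack u s = ∑ j, u (.aux s j) ^ 2
  base_eq : radix Γ * u .base = 1
  bound_eq : v .bound = u .bound
  transition : ∀ p, Transition a₀ a₁ a₂ p u v (M p.1 p.2)

theorem isPolyRel_simulates (A : Type*) [CommRing A] [Algebra A K] (M : TM0.Machine Γ Λ)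
    (a₀ a₁ a₂ : Γ) :
    IsPolyRel A fun w : ℕ → Var (Λ × Γ) → K => Simulates M a₀ a₁ a₂ (w 0) (w 1) := by
  have two : IsPolyFun A fun _ : ℕ → Var (Λ × Γ) → K => (2 : K) := by
    simpa using IsPolyFun.natCast (A := A) (K := K) (V := Var (Λ × Γ)) 2
  have h : IsPolyRel A fun w : ℕ → Var (Λ × Γ) → K =>
      (∀ p, w 0 (.mode p) * w 0 (.mode p) = w 0 (.mode p)) ∧
      (∑ p, w 0 (.mode p) = 1) ∧
      (∀ s, slack (w 0) s = ∑ j, w 0 (.aux s j) ^ 2) ∧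
      (radix Γ * w 0 .base = 1) ∧ (w 1 .bound = w 0 .bound) ∧
      (∀ p, Transition a₀ a₁ a₂ p (w 0) (w 1) (M p.1 p.2)) := by
    refine .and (.all fun p => .eq (.mul (.var _ _) (.var _ _)) (.var _ _)) <|
      .and (.eq (.sum _ fun p => .var _ _) .one) <|
      .and (.all fun s => .eq ?_ (.sum _ fun j => .pow (.var _ _) 2)) <|
      .and (.eq (.mul (.natCast _) (.var _ _)) .one) <|
      .and (.eq (.var _ _) (.var _ _)) (.all fun p => ?_)
    · fin_cases s
      · exact .var _ _
      · exact .sub .one (.mul two (.var _ _))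
      · exact .var _ _
      · exact .sub .one (.mul two (.var _ _))
      · exact .sub (.var _ _) (.var _ _)
    · have time : IsPolyRel A fun w : ℕ → Var (Λ × Γ) → K =>
          w 0 (.mode p) * w 1 .time = w 0 (.mode p) * (w 0 .time + 1) :=
        .eq (.mul (.var _ _) (.var _ _)) (.mul (.var _ _) (.add (.var _ _) .one))
      rcases M p.1 p.2 with _ | ⟨q, (_ | _) | b⟩
      · exact .and (.eq (.mul (.var _ _) (.var _ _)) (.var _ _)) <|
          .and (.eq (.mul (.var _ _) (.var _ _)) .zero) <|
          .and (.eq (.mul (.var _ _)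
            (.mul (.sub (.natCast _) .one) (.mul (.natCast _) (.var _ _))))
            (.mul (.var _ _) (.add (.mul (.sub (.natCast _) .one) (.natCast _))
              (.mul (.natCast _) (.sub .one (.var _ _)))))) <|
          .eq (.mul (.var _ _) (.var _ _)) .zero
      · exact .and (.eq (.mul (.var _ _) (.sum _ fun b => .var _ _)) (.var _ _)) <|
          .and (.eq (.mul (.var _ _) (.mul (.natCast _) (.var _ _)))
            (.mul (.var _ _) (.add (.natCast _) (.var _ _)))) <|
          .and (.eq (.mul (.var _ _) (.add (.var _ _)
            (.sum _ fun b => .mul (.var _ _) (.natCast _))))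
            (.mul (.var _ _) (.mul (.natCast _) (.var _ _)))) time
      · exact .and (.eq (.mul (.var _ _) (.sum _ fun b => .var _ _)) (.var _ _)) <|
          .and (.eq (.mul (.var _ _) (.mul (.natCast _) (.var _ _)))
            (.mul (.var _ _) (.add (.natCast _) (.var _ _)))) <|
          .and (.eq (.mul (.var _ _) (.add (.var _ _)
            (.sum _ fun b => .mul (.var _ _) (.natCast _))))
            (.mul (.var _ _) (.mul (.natCast _) (.var _ _)))) time
      · exact .and (.eq (.mul (.var _ _) (.var _ _)) (.var _ _)) <|
          .and (.eq (.mul (.var _ _) (.var _ _)) (.mul (.var _ _) (.var _ _))) <|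
          .and (.eq (.mul (.var _ _) (.var _ _)) (.mul (.var _ _) (.var _ _))) time
  obtain ⟨E, hE⟩ := h
  exact ⟨E, fun w => Iff.trans ⟨fun h => ⟨h.1, h.2, h.3, h.4, h.5, h.6⟩,
    fun h => ⟨h.1, h.2.1, h.2.2.1, h.2.2.2.1, h.2.2.2.2.1, h.2.2.2.2.2⟩⟩ (hE w)⟩

end Relation

/-! ### Runs and halting -/

section Runs

variable {Γ Λ : Type} [Inhabited Γ] [Inhabited Λ]

/-- The run of a machine, which stays at a halting configuration. -/
def run (M : TM0.Machine Γ Λ) (l : List Γ) : ℕ → TM0.Cfg Γ Λ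
  | 0 => TM0.init l
  | n + 1 => (TM0.step M (run M l n)).getD (run M l n)

theorem halts_iff (M : TM0.Machine Γ Λ) (l : List Γ) :
    Halts M l ↔ ∃ n, TM0.step M (run M l n) = none := by
  have reach : ∀ n, StateTransition.Reaches (TM0.step M) (TM0.init l) (run M l n) := by
    intro n
    induction n with
    | zero => exact Relation.ReflTransGen.refl
    | succ n ih =>
      rcases h : TM0.step M (run M l n) with _ | c
      · rwa [run, h]
      · rw [run, h]
        exact ih.tail h
  constructor
  · intro h
    obtain ⟨h1, h2⟩ := StateTransition.mem_eval.1 (Part.get_mem h)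
    by_contra! hn
    have : ∀ c, StateTransition.Reaches (TM0.step M) (TM0.init l) c → ∃ n, c = run M l n := by
      intro c hc
      induction hc with
      | refl => exact ⟨0, rfl⟩
      | tail _ h ih =>
        obtain ⟨n, rfl⟩ := ih
        exact ⟨n + 1, by rw [run, h]; rfl⟩
    obtain ⟨n, hn'⟩ := this _ h1
    rw [hn'] at h2
    exact hn n h2
  · rintro ⟨n, hn⟩
    exact Part.dom_iff_mem.2 ⟨_, StateTransition.mem_eval.2 ⟨reach n, hn⟩⟩

theorem step_eq_none_iff (M : TM0.Machine Γ Λ) (c : TM0.Cfg Γ Λ) :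
    TM0.step M c = none ↔ M c.q c.Tape.head = none := by
  simp [TM0.step]

end Runs

/-! ### From a solution to a halting run -/

theorem exists_eq_one_of_sum_eq_one {ι K : Type*} [Fintype ι] [Field K] [LinearOrder K]
    [IsStrictOrderedRing K] {e : ι → K} (he : ∀ i, e i * e i = e i) (h : ∑ i, e i = 1) :
    ∃ i, e i = 1 := by
  by_contra! hn
  have : ∀ i, e i = 0 := fun i => by
    by_contra h0
    exact hn i (mul_left_cancel₀ h0 ((he i).trans (mul_one _).symm))
  simp [this] at h

/-- Idempotents are squares, hence nonnegative, so a second nonzero one would push the sum above 1.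
-/
theorem eq_zero_of_sum_eq_one {ι K : Type*} [Fintype ι] [Field K] [LinearOrder K]
    [IsStrictOrderedRing K] {e : ι → K} (he : ∀ i, e i * e i = e i) (h : ∑ i, e i = 1)
    {i j : ι} (hi : e i = 1) (hij : j ≠ i) : e j = 0 := by
  classical
  have nn : ∀ i, 0 ≤ e i := fun i => he i ▸ mul_self_nonneg (e i)
  have h1 : e i + e j ≤ ∑ i, e i := by
    rw [← Finset.sum_pair hij.symm]
    exact Finset.sum_le_univ_sum_of_nonneg nn
  linarith [nn j]

section Forward

variable {Γ Λ : Type} [Inhabited Γ] [Fintype Γ] [Inhabited Λ] [Fintype Λ]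
variable {K : Type*} [Field K] {M : TM0.Machine Γ Λ} {a₀ a₁ a₂ : Γ} {u v v' : Var (Λ × Γ) → K}

theorem Simulates.time_succ (h : Simulates M a₀ a₁ a₂ u v) {p : Λ × Γ} (hp : u (.mode p) = 1)
    (hM : M p.1 p.2 ≠ none) : v .time = u .time + 1 := by
  have t := h.transition p
  rcases e : M p.1 p.2 with _ | ⟨q, (_ | _) | b⟩
  · exact absurd e hM
  all_goals
    rw [e] at t
    simpa [hp] using t.2.2.2

variable [LinearOrder K] [IsStrictOrderedRing K]

/-- The values `u` describe the configuration `c`. -/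
structure Describes (u : Var (Λ × Γ) → K) (c : TM0.Cfg Γ Λ) : Prop where
  mode : u (.mode (c.q, c.Tape.head)) = 1
  left : u .left = (tapeVal c.Tape.left : ℚ)
  right : u .right = (tapeVal c.Tape.right : ℚ)

theorem Simulates.slack_nonneg (h : Simulates M a₀ a₁ a₂ u v) (s : Fin 5) : 0 ≤ slack u s := by
  rw [h.slack_eq]
  exact Finset.sum_nonneg fun j _ => sq_nonneg _

theorem Simulates.left_nonneg (h : Simulates M a₀ a₁ a₂ u v) : 0 ≤ u .left := h.slack_nonneg 0

theorem Simulates.left_le (h : Simulates M a₀ a₁ a₂ u v) : 2 * u .left ≤ 1 :=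
  sub_nonneg.1 (h.slack_nonneg 1)

theorem Simulates.right_nonneg (h : Simulates M a₀ a₁ a₂ u v) : 0 ≤ u .right := h.slack_nonneg 2

theorem Simulates.right_le (h : Simulates M a₀ a₁ a₂ u v) : 2 * u .right ≤ 1 :=
  sub_nonneg.1 (h.slack_nonneg 3)

theorem Simulates.time_le (h : Simulates M a₀ a₁ a₂ u v) : u .time ≤ u .bound :=
  sub_nonneg.1 (h.slack_nonneg 4)

theorem Simulates.exists_mode (h : Simulates M a₀ a₁ a₂ u v) : ∃ p, u (.mode p) = 1 :=
  exists_eq_one_of_sum_eq_one h.idem h.sum_eq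

/-- The mode whose state is prescribed. -/
theorem Simulates.exists_symbol (h : Simulates M a₀ a₁ a₂ u v) {q : Λ}
    (hq : ∑ b, u (.mode (q, b)) = 1) :
    ∃ b, u (.mode (q, b)) = 1 ∧ ∑ a, u (.mode (q, a)) * (digit a : K) = digit b := by
  obtain ⟨b, hb⟩ := exists_eq_one_of_sum_eq_one (fun b => h.idem (q, b)) hq
  refine ⟨b, hb, ?_⟩
  rw [Finset.sum_eq_single b (fun a _ ha => ?_) (by simp), hb, one_mul]
  rw [eq_zero_of_sum_eq_one (fun b => h.idem (q, b)) hq hb ha, zero_mul]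

/-- For a move, the equations fix only the sum of the newly scanned digit and the rest of that
half-tape. The bounds on `v`, supplied by `h'`, make the splitting unique. -/
theorem Simulates.describes_step (h : Simulates M a₀ a₁ a₂ u v) (h' : Simulates M a₀ a₁ a₂ v v')
    {c c' : TM0.Cfg Γ Λ} (hc : Describes u c) (hs : TM0.step M c = some c') : Describes v c' := by
  obtain ⟨q, T⟩ := c
  obtain ⟨hm, hl, hr⟩ := hc
  have hB : (radix Γ : K) ≠ 0 := by exact_mod_cast (radix_pos (Γ := Γ)).ne'
  have t := h.transition (q, T.head)
  have cons (L : ListBlank Γ) (a : Γ) {x : K} (hx : radix Γ * x = digit a + (tapeVal L : ℚ)) :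
      x = (tapeVal (L.cons a) : ℚ) := by
    refine mul_left_cancel₀ hB (hx.trans ?_)
    exact_mod_cast (radix_mul_tapeVal_cons a L).symm
  dsimp only at hm hl hr t
  simp only [TM0.step, Option.map_eq_some_iff] at hs
  obtain ⟨⟨q', s⟩, e, rfl⟩ := hs
  rw [e] at t
  rcases s with (_ | _) | b
  · simp only [Transition, hm, one_mul] at t
    obtain ⟨t1, t2, t3, -⟩ := t
    obtain ⟨b, hb, hb'⟩ := h'.exists_symbol t1
    rw [hb'] at t3
    obtain ⟨rfl, hy⟩ := digit_unique hl h'.left_nonneg h'.left_le t3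
    exact ⟨hb, hy, cons _ _ (by rw [t2, hr])⟩
  · simp only [Transition, hm, one_mul] at t
    obtain ⟨t1, t2, t3, -⟩ := t
    obtain ⟨b, hb, hb'⟩ := h'.exists_symbol t1
    rw [hb'] at t3
    obtain ⟨rfl, hy⟩ := digit_unique hr h'.right_nonneg h'.right_le t3
    exact ⟨hb, cons _ _ (by rw [t2, hl]), hy⟩
  · simp only [Transition, hm, one_mul] at t
    exact ⟨t.1, t.2.1.trans hl, t.2.2.1.trans hr⟩

theorem tapeVal_start (m : ℕ) :
    (radix Γ - 1 : ℚ) * (radix Γ * listVal (a₁ :: List.replicate m a₂)) =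
      (radix Γ - 1) * digit a₁ + digit a₂ * (1 - (radix Γ : ℚ)⁻¹ ^ m) := by
  rw [listVal_cons, mul_div_cancel₀ _ radix_pos.ne', mul_add, listVal_replicate]

theorem Simulates.describes_init (h : Simulates M a₀ a₁ a₂ u v) {p : Λ × Γ}
    (hp : u (.mode p) = 1) (hM : M p.1 p.2 = none) {m : ℕ} (hw : u .pow = u .base ^ m) :
    Describes v (TM0.init (a₀ :: a₁ :: List.replicate m a₂)) := by
  have t := h.transition p
  rw [hM] at t
  simp only [Transition, hp, one_mul] at t
  obtain ⟨t1, t2, t3, -⟩ := t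
  have hB : (radix Γ : K) ≠ 0 := by exact_mod_cast (radix_pos (Γ := Γ)).ne'
  have hB' : (radix Γ - 1 : K) ≠ 0 := sub_ne_zero.2 (by
    exact_mod_cast (one_lt_radix (Γ := Γ)).ne')
  have hb : u .base = (radix Γ : K)⁻¹ := eq_inv_of_mul_eq_one_right h.base_eq
  have h0 : (radix Γ - 1 : ℚ) * (radix Γ *
      tapeVal (TM0.init (Λ := Λ) (a₀ :: a₁ :: List.replicate m a₂)).Tape.right) =
      (radix Γ - 1) * digit a₁ + digit a₂ * (1 - (radix Γ : ℚ)⁻¹ ^ m) := tapeVal_start m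
  refine ⟨t1, by simpa [TM0.init, Tape.mk₁, Tape.mk₂, tapeVal_mk, listVal] using t2, ?_⟩
  refine mul_left_cancel₀ hB (mul_left_cancel₀ hB' (t3.trans ?_))
  rw [hw, hb]
  have h1 := congrArg (Rat.cast : ℚ → K) h0.symm
  push_cast at h1
  exact h1

/-- Without a halt the clock would grow by 1 at each step and pass its constant bound. -/
theorem exists_halt [Archimedean K] {x : ℕ → Var (Λ × Γ) → K}
    (h : ∀ n, Simulates M a₀ a₁ a₂ (x n) (x (n + 1))) (n₀ : ℕ) :
    ∃ n ≥ n₀, ∃ p, x n (.mode p) = 1 ∧ M p.1 p.2 = none := by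
  by_contra! hn
  have time : ∀ n, x (n₀ + n) .time = x n₀ .time + n := by
    intro n
    induction n with
    | zero => simp
    | succ n ih =>
      obtain ⟨p, hp⟩ := (h (n₀ + n)).exists_mode
      rw [← add_assoc, (h (n₀ + n)).time_succ hp (hn _ (Nat.le_add_right _ _) p hp), ih]
      push_cast
      ring
  have bound : ∀ n, x (n₀ + n) .bound = x n₀ .bound := by
    intro n
    induction n with
    | zero => rfl
    | succ n ih => rw [← add_assoc, (h (n₀ + n)).bound_eq, ih]
  obtain ⟨n, hn'⟩ := exists_nat_gt (x n₀ .bound - x n₀ .time)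
  have := (h (n₀ + n)).time_le
  rw [time, bound] at this
  linarith

theorem halts_of_simulates [Archimedean K] {x : ℕ → Var (Λ × Γ) → K} {m : ℕ}
    (h : ∀ n, Simulates M a₀ a₁ a₂ (x n) (x (n + 1))) (hw : ∀ n, x n .pow = x n .base ^ m) :
    Halts M (a₀ :: a₁ :: List.replicate m a₂) := by
  rw [halts_iff]
  by_contra! hn
  obtain ⟨n₀, -, p, hp, hM⟩ := exists_halt h 0
  -- The values at `n₀` are those of a halt and may be spurious; the genuine run begins one index
  -- later.
  have desc : ∀ n, Describes (x (n₀ + 1 + n))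
      (run M (a₀ :: a₁ :: List.replicate m a₂) n) := by
    intro n
    induction n with
    | zero => exact (h n₀).describes_init hp hM (hw n₀)
    | succ n ih =>
      obtain ⟨c, hc⟩ := Option.ne_none_iff_exists'.1 (hn n)
      rw [run, hc]
      exact (h _).describes_step (h _) ih hc
  obtain ⟨n, hn₀, p, hp, hM⟩ := exists_halt h (n₀ + 1)
  obtain ⟨n, rfl⟩ := Nat.exists_eq_add_of_le hn₀
  refine hn n ((step_eq_none_iff _ _).2 ?_)
  -- The halting mode found in the solution is the mode of the genuine run, since only one indicator
  -- is nonzero.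
  by_contra hne
  have : p ≠ ((run M (a₀ :: a₁ :: List.replicate m a₂) n).q,
      (run M (a₀ :: a₁ :: List.replicate m a₂) n).Tape.head) := by
    rintro rfl
    exact hne hM
  rw [eq_zero_of_sum_eq_one (h _).idem (h _).sum_eq (desc n).mode this] at hp
  exact zero_ne_one hp

end Forward

/-! ### From a halting run to a periodic solution -/

section Backward

/-- Lagrange's theorem for numerator times denominator, divided by the squared denominator. The
roots are rational, so they exist in every field of characteristic 0. -/
theorem exists_four_squares {q : ℚ} (hq : 0 ≤ q) : ∃ f : Fin 4 → ℚ, q = ∑ j, f j ^ 2 := by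
  obtain ⟨a, b, c, d, h⟩ := Nat.sum_four_squares (q.num.toNat * q.den)
  have hd : (q.den : ℚ) ≠ 0 := by exact_mod_cast q.den_ne_zero
  refine ⟨![a / q.den, b / q.den, c / q.den, d / q.den], ?_⟩
  have h' : (a ^ 2 + b ^ 2 + c ^ 2 + d ^ 2 : ℚ) = q * q.den * q.den := by
    rw [Rat.mul_den_eq_num]
    have : ((q.num.toNat : ℤ) : ℚ) = q.num := by
      rw [Int.toNat_of_nonneg (Rat.num_nonneg.2 hq)]
    rw [← this]
    exact_mod_cast h
  simp only [Fin.sum_univ_four, Matrix.cons_val, div_pow]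
  field_simp
  linear_combination -h'

variable {Γ Λ : Type} [Inhabited Γ] [Fintype Γ]

open scoped Classical in
/-- The values that describe the configuration `c` at the time `n`. -/
noncomputable def values (m T n : ℕ) (c : TM0.Cfg Γ Λ) (r : Fin 5 → Fin 4 → ℚ) :
    Var (Λ × Γ) → ℚ
  | .mode p => if p = (c.q, c.Tape.head) then 1 else 0
  | .left => tapeVal c.Tape.left
  | .right => tapeVal c.Tape.right
  | .time => n
  | .bound => T
  | .base => (radix Γ : ℚ)⁻¹
  | .pow => (radix Γ : ℚ)⁻¹ ^ m
  | .aux s j => r s j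

theorem sum_mode_values (m T n : ℕ) (c : TM0.Cfg Γ Λ) (r : Fin 5 → Fin 4 → ℚ) (g : Γ → ℚ) :
    ∑ b, values m T n c r (.mode (c.q, b)) * g b = g c.Tape.head := by
  classical
  simp [values]

/-- The slacks do not involve the roots, which is why `r` can be chosen uniformly in `r'`. -/
theorem exists_roots {m T n : ℕ} (hn : n ≤ T) (c : TM0.Cfg Γ Λ) :
    ∃ r : Fin 5 → Fin 4 → ℚ, ∀ r', ∀ s, slack (values m T n c r') s = ∑ j, r s j ^ 2 := by
  have hn' : (n : ℚ) ≤ T := by exact_mod_cast hn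
  have : ∀ s, 0 ≤ slack (values m T n c fun _ _ => 0) s := by
    intro s
    fin_cases s
    · exact tapeVal_nonneg _
    · exact sub_nonneg.2 (two_mul_tapeVal_le _)
    · exact tapeVal_nonneg _
    · exact sub_nonneg.2 (two_mul_tapeVal_le _)
    · exact sub_nonneg.2 hn'
  choose r hr using fun s => exists_four_squares (this s)
  exact ⟨r, fun r' s => hr s⟩

variable [Inhabited Λ] {M : TM0.Machine Γ Λ} {a₀ a₁ a₂ : Γ}

theorem Transition.map {K : Type*} [Field K] [CharZero K] {p : Λ × Γ} {u v : Var (Λ × Γ) → ℚ}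
    {o : Option (Λ × TM0.Stmt Γ)} (h : Transition a₀ a₁ a₂ p u v o) :
    Transition a₀ a₁ a₂ p (fun i => (u i : K)) (fun i => (v i : K)) o := by
  rcases o with _ | ⟨q, (_ | _) | b⟩ <;>
  · simp only [Transition] at h ⊢
    exact_mod_cast h

theorem transition_values {m T n n' : ℕ} {c c' : TM0.Cfg Γ Λ} {r r' : Fin 5 → Fin 4 → ℚ}
    {p : Λ × Γ} (h : (TM0.step M c = none ∧ n' = 0 ∧
      c' = TM0.init (a₀ :: a₁ :: List.replicate m a₂)) ∨ (TM0.step M c = some c' ∧ n' = n + 1)) :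
    Transition a₀ a₁ a₂ p (values m T n c r) (values m T n' c' r') (M p.1 p.2) := by
  by_cases hp : p = (c.q, c.Tape.head)
  swap
  · have : values m T n c r (.mode p) = 0 := if_neg hp
    rcases M p.1 p.2 with _ | ⟨q, (_ | _) | b⟩ <;> simp [Transition, this]
  have h1 : values m T n c r (.mode p) = 1 := if_pos hp
  subst hp
  obtain ⟨hs, rfl, rfl⟩ | ⟨hs, rfl⟩ := h
  · rw [(step_eq_none_iff M c).1 hs]
    simp only [Transition, h1, one_mul]
    refine ⟨if_pos rfl, ?_, ?_, ?_⟩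
    · simp [values, TM0.init, Tape.mk₁, Tape.mk₂, tapeVal_mk, listVal]
    · exact tapeVal_start m
    · simp [values]
  · obtain ⟨q, S⟩ := c
    simp only [TM0.step, Option.map_eq_some_iff] at hs
    obtain ⟨⟨q', s⟩, e, rfl⟩ := hs
    have time : values m T (n + 1) ⟨q', match s with
        | .move d => S.move d
        | .write a => S.write a⟩ r' .time =
        values m T n ⟨q, S⟩ r .time + 1 := Nat.cast_succ n
    dsimp only at h1 ⊢
    rw [e]
    rcases s with (_ | _) | b
    · simp only [Transition, h1, one_mul]
      refine ⟨?_, radix_mul_tapeVal_cons _ _, ?_, time⟩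
      · simpa using sum_mode_values m T (n + 1) ⟨q', S.move .left⟩ r' fun _ => 1
      · refine (congrArg _ (sum_mode_values m T (n + 1) ⟨q', S.move .left⟩ r'
          fun b => digit b)).trans ?_
        exact (add_comm _ _).trans (radix_mul_tapeVal S.left).symm
    · simp only [Transition, h1, one_mul]
      refine ⟨?_, radix_mul_tapeVal_cons _ _, ?_, time⟩
      · simpa using sum_mode_values m T (n + 1) ⟨q', S.move .right⟩ r' fun _ => 1
      · refine (congrArg _ (sum_mode_values m T (n + 1) ⟨q', S.move .right⟩ r'
          fun b => digit b)).trans ?_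
        exact (add_comm _ _).trans (radix_mul_tapeVal S.right).symm
    · simp only [Transition, h1, one_mul]
      exact ⟨if_pos rfl, rfl, rfl, time⟩

variable [Fintype Λ]

theorem simulates_values {m T n n' : ℕ} {c c' : TM0.Cfg Γ Λ}
    {r r' : Fin 5 → Fin 4 → ℚ} (hr : ∀ s, slack (values m T n c r) s = ∑ j, r s j ^ 2)
    (h : (TM0.step M c = none ∧ n' = 0 ∧
      c' = TM0.init (a₀ :: a₁ :: List.replicate m a₂)) ∨ (TM0.step M c = some c' ∧ n' = n + 1)) :
    Simulates M a₀ a₁ a₂ (values m T n c r) (values m T n' c' r') where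
  idem p := by simp [values]
  sum_eq := by simp [values]
  slack_eq := hr
  base_eq := mul_inv_cancel₀ radix_pos.ne'
  bound_eq := rfl
  transition p := transition_values h

theorem Simulates.map (K : Type*) [Field K] [CharZero K] {u v : Var (Λ × Γ) → ℚ}
    (h : Simulates M a₀ a₁ a₂ u v) :
    Simulates M a₀ a₁ a₂ (fun i => (u i : K)) (fun i => (v i : K)) where
  idem p := by exact_mod_cast h.idem p
  sum_eq := by exact_mod_cast h.sum_eq
  slack_eq s := by
    have : slack (fun i => (u i : K)) s = (slack u s : ℚ) := by
      fin_cases s <;> simp [slack]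
    rw [this, h.slack_eq]
    push_cast
    rfl
  base_eq := by exact_mod_cast h.base_eq
  bound_eq := by exact_mod_cast h.bound_eq
  transition p := (h.transition p).map

theorem exists_simulates_of_halts (K : Type*) [Field K] [CharZero K] {m : ℕ}
    (h : Halts M (a₀ :: a₁ :: List.replicate m a₂)) :
    ∃ (T : ℕ) (y : ℕ → Var (Λ × Γ) → K), (∀ n, y n .pow = y n .base ^ m) ∧
      (∀ n < T, Simulates M a₀ a₁ a₂ (y n) (y (n + 1))) ∧ Simulates M a₀ a₁ a₂ (y T) (y 0) := by
  classical
  have hex := (halts_iff _ _).1 h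
  let l := a₀ :: a₁ :: List.replicate m a₂
  -- The first halting time is the bound of the clock and the last index of the period.
  let T := Nat.find hex
  have hr : ∀ n, ∃ r : Fin 5 → Fin 4 → ℚ, n ≤ T → ∀ r', ∀ s,
      slack (values m T n (run M l n) r') s = ∑ j, r s j ^ 2 := fun n => by
    by_cases hn : n ≤ T
    · obtain ⟨r, hr⟩ := exists_roots (m := m) hn (run M l n)
      exact ⟨r, fun _ => hr⟩
    · exact ⟨0, fun h => absurd h hn⟩
  choose r hr using hr
  refine ⟨T, fun n i => (values m T n (run M l n) (r n) i : ℚ), fun n => ?_, fun n hn => ?_, ?_⟩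
  · simp [values]
  · refine (simulates_values (hr n hn.le _) (.inr ⟨?_, rfl⟩)).map K
    obtain ⟨c, hc⟩ := Option.ne_none_iff_exists'.1 (Nat.find_min hex hn)
    rw [run, hc]
    rfl
  · exact (simulates_values (hr T le_rfl _) (.inl ⟨Nat.find_spec hex, rfl, rfl⟩)).map K

end Backward

/-! ### Periodic index functions and the reduction -/

/-- An index set on which there are functions that run periodically through `0, …, T`. -/
class HasResidues (M : Type*) [AddMonoidWithOne M] : Prop where
  exists_residue : ∀ T : ℕ, ∃ r : M → ℕ, ∀ i,
    r i ≤ T ∧ (r i < T → r (i + 1) = r i + 1) ∧ (r i = T → r (i + 1) = 0)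

instance : HasResidues ℤ where
  exists_residue T := by
    refine ⟨fun i => (i % (T + 1)).toNat, fun i => ?_⟩
    have h0 := Int.emod_nonneg i (by omega : (T + 1 : ℤ) ≠ 0)
    have h1 := Int.emod_lt_of_pos i (by omega : (0 : ℤ) < T + 1)
    have h2 : (i + 1) % (T + 1 : ℤ) = (i % (T + 1) + 1) % (T + 1) :=
      (Int.emod_add_emod i (T + 1) 1).symm
    refine ⟨by dsimp only; omega, fun h => ?_, fun h => ?_⟩ <;> dsimp only at h ⊢ <;> rw [h2]
    · rw [Int.emod_eq_of_lt (by omega) (by omega)]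
      omega
    · rw [show i % (T + 1 : ℤ) + 1 = T + 1 by omega, Int.emod_self]
      rfl

instance : HasResidues ℕ where
  exists_residue T := by
    obtain ⟨r, hr⟩ := HasResidues.exists_residue (M := ℤ) T
    exact ⟨fun i => r i, fun i => by simpa using hr i⟩

theorem solvable_iff_halts {Γ Λ : Type} [Inhabited Γ] [Fintype Γ] [Inhabited Λ] [Fintype Λ]
    {I K : Type*} [AddMonoidWithOne I] [HasResidues I] [Field K] [LinearOrder K]
    [IsStrictOrderedRing K] [Archimedean K] (M : TM0.Machine Γ Λ) (a₀ a₁ a₂ : Γ) (m : ℕ) :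
    (∃ x : I → Var (Λ × Γ) → K, ∀ i,
      Simulates M a₀ a₁ a₂ (x (i + (0 : ℕ))) (x (i + (1 : ℕ))) ∧
        x i .pow = x i .base ^ m) ↔ Halts M (a₀ :: a₁ :: List.replicate m a₂) := by
  simp only [Nat.cast_zero, Nat.cast_one, add_zero]
  constructor
  · rintro ⟨x, hx⟩
    -- Restriction to the images of natural numbers suffices, also for ℤ.
    refine halts_of_simulates (x := fun n : ℕ => x n) (fun n => ?_) fun n => (hx n).2
    have := (hx n).1
    rwa [← Nat.cast_succ] at this
  · intro h
    obtain ⟨T, y, hw, h1, h2⟩ := exists_simulates_of_halts K h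
    obtain ⟨r, hr⟩ := HasResidues.exists_residue (M := I) T
    refine ⟨fun i => y (r i), fun i => ⟨?_, hw _⟩⟩
    obtain ⟨le, lt, eq⟩ := hr i
    rcases le.lt_or_eq with h | h
    · simpa only [lt h] using h1 _ h
    · simpa only [eq h, h] using h2

theorem not_isDecidableProblem {A : Type*} [CommRing A] {ν : ℕ → A}
    (hν : Function.Surjective ν) (I K : Type*) [AddMonoidWithOne I] [HasResidues I] [Field K]
    [LinearOrder K] [IsStrictOrderedRing K] [Archimedean K] [Algebra A K] :
    ¬ IsDecidableProblem ν fun F : DiffSystem A => F.HasSolution I K := by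
  intro hdec
  have hf : Partrec fun n : ℕ => (Denumerable.ofNat Nat.Partrec.Code n).eval 0 :=
    Nat.Partrec.Code.eval_part.comp (Computable.ofNat _) (Computable.const 0)
  obtain ⟨Γ, Λ, _, _, _, _, M, a₀, a₁, a₂, hM⟩ := exists_machine_of_partrec hf
  have hcomp := computablePred_of_isDecidableProblem hν hdec
    (isPolyRel_simulates (K := K) A M a₀ a₁ a₂) .base .pow
  have hdom := hcomp.of_eq fun m => (solvable_iff_halts (I := I) M a₀ a₁ a₂ m).trans (hM m)
  refine ComputablePred.halting_problem 0 ?_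
  refine ComputablePred.computable_of_manyOneReducible
    ⟨Encodable.encode, Computable.encode, fun c => ?_⟩ hdom
  simp

end DiffEq

theorem mainTheorem5 (k : Subfield ℝ) (k₀ : Subfield k) (ν : ℕ → k₀)
    (hν : DiffEq.IsComputablePresentation ν) :
    (¬ DiffEq.IsDecidableProblem ν fun F : DiffEq.DiffSystem k₀ => F.HasSolution ℕ k) ∧
    (¬ DiffEq.IsDecidableProblem ν fun F : DiffEq.DiffSystem k₀ => F.HasSolution ℤ k) := by
  exact ⟨DiffEq.not_isDecidableProblem hν.surjective ℕ k,
    DiffEq.not_isDecidableProblem hν.surjective ℤ k⟩
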